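/- Let $n\ge 3$. Let $B_n^+$ be the monoid of positive $n$-strand braids, generated by $\sigma_1,\dots,\sigma_{n-1}$ subject to $\sigma_i\sigma_j=\sigma_j\sigma_i$ for $|i-j|\ge 2$ and $\sigma_i\sigma_j\sigma_i=\sigma_j\sigma_i\sigma_j$ for $|i-j|=1$. View $B_{n-1}^+$ as the submonoid of $B_n^+$ generated by $\sigma_1,\dots,\sigma_{n-2}$, and let $\Phi_n$ be the flip automorphism of $B_n^+$, which maps $\sigma_i$ to $\sigma_{n-i}$ for each $i$. We say that $z$ is a right divisor of $y$ if $y=qz$ for some $q\in B_n^+$; this $q$ is then unique and is denoted $yz^{-1}$. For each $y\in B_n^+$ there is a unique right divisor of $y$ lying in $B_{n-1}^+$ of which every right divisor of $y$ lying in $B_{n-1}^+$ is a right divisor; it is denoted $\mathrm{tail}(y,B_{n-1}^+)$. Every braid $x\in B_n^+$ admits a unique decomposition $$x=\Phi_n^{p-1}(x_p)\cdots\Phi_n(x_2)\cdot x_1,\qquad p\ge 1,$$ with $x_1,\dots,x_p\in B_{n-1}^+$ such that, for each $r$ with $2\le r\le p$, the braid $\Phi_n^{p-r}(x_p)\cdots\Phi_n(x_{r+1})\cdot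 x_r$ is right divisible by $\sigma_1$ and by no other $\sigma_i$; here both the length $p$ and the sequence $(x_p,\dots,x_1)$ are unique. The braids $x_r$ are determined from $x^{(0)}=x$ by $$x_r=\mathrm{tail}(x^{(r-1)},B_{n-1}^+),\qquad x^{(r)}=\Phi_n\bigl(x^{(r-1)}x_r^{-1}\bigr),$$ and $p$ is the least integer $p\ge 1$ such that $x^{(p)}=1$. -/

import Mathlib

/-- Defining relations of the monoid of positive `n`-strand braids. The generators are indexed by
`Fin (n - 1)`, the index `i` standing for the standard generator `σ_{i+1}`. -/
inductive PosBraidRel (n : ℕ) : FreeMonoid (Fin (n - 1)) → FreeMonoid (Fin (n - 1)) → Prop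
  | comm (i j : Fin (n - 1)) (h : i.val + 2 ≤ j.val ∨ j.val + 2 ≤ i.val) :
      PosBraidRel n (.of i * .of j) (.of j * .of i)
  | braid (i j : Fin (n - 1)) (h : i.val + 1 = j.val ∨ j.val + 1 = i.val) :
      PosBraidRel n (.of i * .of j * .of i) (.of j * .of i * .of j)

/-- The monoid `B_n^+` of positive `n`-strand braids. -/
abbrev PosBraid (n : ℕ) : Type := PresentedMonoid (PosBraidRel n)

namespace PosBraid

/-- `σ n i` is the standard generator `σ_{i+1}` of `B_n^+`, for `0 ≤ i < n - 1`. -/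
def σ (n : ℕ) (i : Fin (n - 1)) : PosBraid n := PresentedMonoid.of (PosBraidRel n) i

theorem σ_comm (n : ℕ) (i j : Fin (n - 1)) (h : i.val + 2 ≤ j.val ∨ j.val + 2 ≤ i.val) :
    σ n i * σ n j = σ n j * σ n i :=
  PresentedMonoid.mk_eq_mk_of_rel (PosBraidRel.comm i j h)

theorem σ_braid (n : ℕ) (i j : Fin (n - 1)) (h : i.val + 1 = j.val ∨ j.val + 1 = i.val) :
    σ n i * σ n j * σ n i = σ n j * σ n i * σ n j :=
  PresentedMonoid.mk_eq_mk_of_rel (PosBraidRel.braid i j h)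

/-- The flip `Φ_n` of `B_n^+`: it maps `σ_k` to `σ_{n-k}`, that is, reverses the indices. -/
def flip (n : ℕ) : PosBraid n →* PosBraid n :=
  PresentedMonoid.lift (fun i => σ n i.rev) (by
    intro a b h
    cases h with
    | comm i j h =>
      simpa using σ_comm n i.rev j.rev (by simp only [Fin.val_rev]; omega)
    | braid i j h =>
      simpa using σ_braid n i.rev j.rev (by simp only [Fin.val_rev]; omega))

/-- The canonical homomorphism `B_{n-1}^+ → B_n^+`, mapping each `σ_k` to `σ_k`. -/
def incl (n : ℕ) : PosBraid (n - 1) →* PosBraid n :=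
  PresentedMonoid.lift (fun i => σ n (Fin.castLE (Nat.sub_le (n - 1) 1) i)) (by
    intro a b h
    cases h with
    | comm i j h =>
      simpa using σ_comm n (Fin.castLE (Nat.sub_le (n - 1) 1) i)
        (Fin.castLE (Nat.sub_le (n - 1) 1) j) h
    | braid i j h =>
      simpa using σ_braid n (Fin.castLE (Nat.sub_le (n - 1) 1) i)
        (Fin.castLE (Nat.sub_le (n - 1) 1) j) h)

/-- `B_{n-1}^+` viewed as a submonoid of `B_n^+`. -/
def sub (n : ℕ) : Submonoid (PosBraid n) := MonoidHom.mrange (incl n)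

/-- The map `B_n^+ → B_{n-1}^+ ∪ {0}` sending the last generator to `0`; it is only used to check
that `incl` is injective. -/
def retract (n : ℕ) : PosBraid n →* WithZero (PosBraid (n - 1)) :=
  PresentedMonoid.lift
    (fun i => if h : i.val < n - 1 - 1 then ((σ (n - 1) ⟨i.val, h⟩ : PosBraid (n - 1)) :
      WithZero (PosBraid (n - 1))) else 0) (by
    intro a b h
    cases h with
    | comm i j h =>
      by_cases hi : i.val < n - 1 - 1 <;> by_cases hj : j.val < n - 1 - 1 <;>
        simp [hi, hj]
      exact_mod_cast σ_comm (n - 1) ⟨i, hi⟩ ⟨j, hj⟩ h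
    | braid i j h =>
      by_cases hi : i.val < n - 1 - 1 <;> by_cases hj : j.val < n - 1 - 1 <;>
        simp [hi, hj]
      exact_mod_cast σ_braid (n - 1) ⟨i, hi⟩ ⟨j, hj⟩ h)

/-- The identification of `B_{n-1}^+` with a submonoid of `B_n^+` is legitimate. -/
theorem incl_injective (n : ℕ) : Function.Injective (incl n) := by
  have key : (retract n).comp (incl n) =
      (WithZero.coeMonoidHom : PosBraid (n - 1) →* WithZero (PosBraid (n - 1))) := by
    apply PresentedMonoid.ext
    intro i
    simp [retract, incl, σ]
  intro a b hab
  have h := congrArg (retract n) hab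
  rw [← MonoidHom.comp_apply, ← MonoidHom.comp_apply, key] at h
  exact WithZero.coe_injective h

end PosBraid

/-- `t` is the `A`-tail of `x`: the greatest, with respect to right divisibility, of the right
divisors of `x` that lie in `A`. -/
def IsTail {M : Type*} [Monoid M] (x : M) (A : Set M) (t : M) : Prop :=
  t ∈ A ∧ RightDvd t x ∧ ∀ z ∈ A, RightDvd z x → RightDvd z t

open Classical in
/-- The `A`-tail `tail(x, A)` of `x` (with the value `1` if there is none). -/
noncomputable def tail {M : Type*} [Monoid M] (x : M) (A : Set M) : M :=
  if h : ∃ t, IsTail x A t then h.choose else 1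

open Classical in
/-- The right quotient `x y⁻¹`, i.e. the element `q` with `x = q y` (with the value `1` if there
is none). -/
noncomputable def rightQuot {M : Type*} [Monoid M] (x y : M) : M :=
  if h : ∃ q : M, x = q * y then h.choose else 1

namespace PosBraid

/-- For `L = [y_1, …, y_m]`, the product `Φ_n^{m-1}(y_m) ⋯ Φ_n(y_2) · y_1`. -/
def flipProd (n : ℕ) (L : List (PosBraid n)) : PosBraid n :=
  (L.mapIdx fun k y => (flip n)^[k] y).reverse.prod

/-- `L = [x_1, …, x_p]` (with `p ≥ 1`) is an `n`-splitting of `x`: the entries lie in `B_{n-1}^+`,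
`x = Φ_n^{p-1}(x_p) ⋯ Φ_n(x_2) · x_1`, and, for `2 ≤ r ≤ p`, the generator `σ_1` (index `0`) is a
right divisor of `Φ_n^{p-r}(x_p) ⋯ Φ_n(x_{r+1}) · x_r`, and the only `σ_i` that is. -/
def IsSplitting (n : ℕ) (x : PosBraid n) (L : List (PosBraid n)) : Prop :=
  L ≠ [] ∧ (∀ y ∈ L, y ∈ sub n) ∧ x = flipProd n L ∧
    ∀ r : ℕ, 2 ≤ r → r ≤ L.length →
      ∀ i : Fin (n - 1), RightDvd (σ n i) (flipProd n (L.drop (r - 1))) ↔ i.val = 0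

/-- The braids `x^{(r)}`: `x^{(0)} = x`, and `x^{(r+1)} = Φ_n(x^{(r)} t⁻¹)` where `t` is the
`B_{n-1}^+`-tail of `x^{(r)}`. -/
noncomputable def remainder (n : ℕ) (x : PosBraid n) : ℕ → PosBraid n
  | 0 => x
  | r + 1 => flip n (rightQuot (remainder n x r) (tail (remainder n x r) (sub n)))

end PosBraid

/-! Everything rests on one fact about right divisors, `lcmFactor_of_mul_σ_eq`: if `a * σ n i = b *
σ n j`, this element is a left multiple of the left lcm of the two generators, with the same
cofactor on both sides. Right cancellation is the consequence of the case `i = j`. The fact is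
proved by Garside's induction on length: along a derivation between two words, the only difficulty
is chaining two such factorizations (`LcmFactor.trans`), which is a finite check on three generators
using the fact for shorter braids.

Divisors of elements of `sub n` stay in `sub n`, so common left multiples can be built inside it
(`exists_common_multiple`); a longest right divisor in `sub n` is therefore the tail.

If `t` is the tail of `q * t`, no generator of `sub n` right-divides `q`; so if `q ≠ 1`, only the
last generator does, and only the first right-divides `flip n q`. Conversely, this condition makes
`t` the tail (`isTail_flip_mul`). A splitting is thus the same as iterated removal of tails, whence
uniqueness. The process stops because, once the first generator is a right divisor, it lies in `sub
n` and the tail is nontrivial. -/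

namespace PosBraid

variable {n : ℕ}

/-! ### Length and induction on generators -/

/-- The length of a positive braid, as a homomorphism. -/
def lengthHom (n : ℕ) : PosBraid n →* Multiplicative ℕ :=
  PresentedMonoid.lift (fun _ => Multiplicative.ofAdd 1) (by
    intro a b h
    cases h <;> rfl)

/-- The length of a positive braid: the length of any word representing it. -/
def len (x : PosBraid n) : ℕ := (lengthHom n x).toAdd

@[simp] theorem len_one : len (1 : PosBraid n) = 0 := by simp [len]

@[simp] theorem len_mul (x y : PosBraid n) : len (x * y) = len x + len y := by simp [len]

@[simp] theorem len_σ (i : Fin (n - 1)) : len (σ n i) = 1 := rfl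

/-- Induction on positive braids by right multiplication by generators. -/
theorem right_induction {p : PosBraid n → Prop} (one : p 1)
    (mul_σ : ∀ x i, p x → p (x * σ n i)) (x : PosBraid n) : p x := by
  have hx : x ∈ Submonoid.closure (Set.range (σ n)) := by
    have h := PresentedMonoid.closure_range_of (PosBraidRel n)
    exact h ▸ Submonoid.mem_top x
  induction hx using Submonoid.closure_induction_right with
  | one => exact one
  | mul_right x hx y hy ih => obtain ⟨i, rfl⟩ := hy; exact mul_σ x i ih

theorem eq_one_or_eq_mul_σ (x : PosBraid n) : x = 1 ∨ ∃ y i, x = y * σ n i :=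
  right_induction (p := fun x => x = 1 ∨ ∃ y i, x = y * σ n i) (.inl rfl)
    (fun x i _ => .inr ⟨x, i, rfl⟩) x

theorem eq_one_of_len_eq_zero {x : PosBraid n} (h : len x = 0) : x = 1 := by
  obtain rfl | ⟨y, i, rfl⟩ := eq_one_or_eq_mul_σ x
  · rfl
  · simp at h

/-! ### Left lcms of two generators -/

/-- Two generators `σ i`, `σ j` are adjacent, i.e. satisfy a braid relation of length three. -/
def Adj (i j : Fin (n - 1)) : Prop := i.val + 1 = j.val ∨ j.val + 1 = i.val

instance (i j : Fin (n - 1)) : Decidable (Adj i j) := inferInstanceAs (Decidable (_ ∨ _))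

/-- The element `c` such that `c * σ i` is the left lcm of `σ i` and `σ j`. -/
def compl (i j : Fin (n - 1)) : PosBraid n :=
  if i = j then 1 else if Adj i j then σ n i * σ n j else σ n j

theorem Adj.symm {i j : Fin (n - 1)} (h : Adj i j) : Adj j i := Or.symm h

theorem Adj.ne {i j : Fin (n - 1)} (h : Adj i j) : i ≠ j := by
  rintro rfl; simp [Adj] at h

theorem compl_self (i : Fin (n - 1)) : compl i i = 1 := by simp [compl]

theorem compl_of_adj {i j : Fin (n - 1)} (h : Adj i j) : compl i j = σ n i * σ n j := by
  simp [compl, h, h.ne]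

theorem compl_of_not_adj {i j : Fin (n - 1)} (hne : i ≠ j) (h : ¬ Adj i j) :
    compl i j = σ n j := by
  simp [compl, h, hne]

theorem σ_mul_σ_of_not_adj {i j : Fin (n - 1)} (hne : i ≠ j) (h : ¬ Adj i j) :
    σ n i * σ n j = σ n j * σ n i := by
  refine σ_comm n i j ?_
  simp only [Adj] at h
  have := Fin.val_ne_of_ne hne
  omega

theorem σ_braid_of_adj {i j : Fin (n - 1)} (h : Adj i j) :
    σ n i * σ n j * σ n i = σ n j * σ n i * σ n j := σ_braid n i j h

theorem compl_mul_σ (i j : Fin (n - 1)) : compl i j * σ n i = compl j i * σ n j := by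
  by_cases hij : i = j
  · subst hij; rfl
  by_cases h : Adj i j
  · rw [compl_of_adj h, compl_of_adj h.symm, σ_braid_of_adj h]
  · rw [compl_of_not_adj hij h, compl_of_not_adj (Ne.symm hij) (fun h' => h h'.symm),
      σ_mul_σ_of_not_adj hij h]

/-- `a * σ i` and `b * σ j` are the same left multiple of the left lcm of `σ i` and `σ j`. -/
def LcmFactor (a : PosBraid n) (i : Fin (n - 1)) (b : PosBraid n) (j : Fin (n - 1)) : Prop :=
  ∃ c, a = c * compl i j ∧ b = c * compl j i

theorem LcmFactor.symm {a b : PosBraid n} {i j : Fin (n - 1)} (h : LcmFactor a i b j) :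
    LcmFactor b j a i := let ⟨c, h₁, h₂⟩ := h; ⟨c, h₂, h₁⟩

/-- All coincidences `a * σ i = b * σ j` with `len a < N` come from left lcms. -/
def LcmFactorBelow (n N : ℕ) : Prop :=
  ∀ (a b : PosBraid n) (i j : Fin (n - 1)), len a < N → a * σ n i = b * σ n j → LcmFactor a i b j

section Below

variable {N : ℕ} {a b : PosBraid n} {i j : Fin (n - 1)}

theorem LcmFactorBelow.cancel (H : LcmFactorBelow n N) (ha : len a < N)
    (h : a * σ n i = b * σ n i) : a = b := by
  obtain ⟨c, rfl, rfl⟩ := H a b i i ha h; rfl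

theorem LcmFactorBelow.comm (H : LcmFactorBelow n N) (ha : len a < N)
    (h : a * σ n i = b * σ n j) (hne : i ≠ j) (hij : ¬ Adj i j) :
    ∃ c, a = c * σ n j ∧ b = c * σ n i := by
  obtain ⟨c, rfl, rfl⟩ := H a b i j ha h
  exact ⟨c, by rw [compl_of_not_adj hne hij],
    by rw [compl_of_not_adj hne.symm (fun h' => hij h'.symm)]⟩

theorem LcmFactorBelow.braid (H : LcmFactorBelow n N) (ha : len a < N)
    (h : a * σ n i = b * σ n j) (hij : Adj i j) :
    ∃ c, a = c * σ n i * σ n j ∧ b = c * σ n j * σ n i := by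
  obtain ⟨c, rfl, rfl⟩ := H a b i j ha h
  exact ⟨c, by rw [compl_of_adj hij, mul_assoc], by rw [compl_of_adj hij.symm, mul_assoc]⟩

end Below

/-! ### Chaining lcm factorizations through a third generator -/

section Trans

variable {N : ℕ} {c c' : PosBraid n} {i j k : Fin (n - 1)}

theorem mul_σ_mul_σ_of_not_adj (hij : i ≠ j) (nij : ¬ Adj i j) (w : PosBraid n) :
    w * σ n i * σ n j = w * σ n j * σ n i := by
  rw [mul_assoc, σ_mul_σ_of_not_adj hij nij, mul_assoc]

theorem mul_σ_braid_of_adj (h : Adj i j) (w : PosBraid n) :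
    w * σ n i * σ n j * σ n i = w * σ n j * σ n i * σ n j := by
  simpa only [mul_assoc] using congrArg (w * ·) (σ_braid_of_adj h)

/-- This and the next three lemmas settle, up to exchanging `i` and `k`, the adjacency patterns of
three distinct generators. Removing last letters from the hypothesis leaves equations short enough
for `H`; here `σ n j` commutes with both others and is simply carried along. -/
theorem lcmFactor_of_comm_comm (H : LcmFactorBelow n N) (hij : i ≠ j) (hjk : j ≠ k) (hik : i ≠ k)
    (nij : ¬ Adj i j) (njk : ¬ Adj j k) (hN : len (c * σ n i) ≤ N)
    (h : c * σ n i = c' * σ n k) : LcmFactor (c * σ n j) i (c' * σ n j) k := by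
  have rij := mul_σ_mul_σ_of_not_adj hij nij
  have rjk := mul_σ_mul_σ_of_not_adj hjk njk
  simp only [len_mul, len_σ] at hN
  by_cases nik : Adj i k
  · obtain ⟨f, rfl, rfl⟩ := H.braid (by omega) h nik
    refine ⟨f * σ n j, ?_, ?_⟩
    · rw [compl_of_adj nik, ← rjk, rij, mul_assoc]
    · rw [compl_of_adj nik.symm, rij, ← rjk, mul_assoc]
  · obtain ⟨f, rfl, rfl⟩ := H.comm (by omega) h hik nik
    refine ⟨f * σ n j, ?_, ?_⟩
    · rw [compl_of_not_adj hik nik, rjk]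
    · rw [compl_of_not_adj hik.symm (fun h => nik h.symm), rij]

theorem lcmFactor_of_braid_comm_comm (H : LcmFactorBelow n N) (hjk : j ≠ k) (hik : i ≠ k)
    (aij : Adj i j) (njk : ¬ Adj j k) (nik : ¬ Adj i k) (hN : len (c * σ n j * σ n i) ≤ N)
    (h : c * σ n j * σ n i = c' * σ n k) :
    LcmFactor (c * σ n i * σ n j) i (c' * σ n j) k := by
  have rij := mul_σ_braid_of_adj aij
  have rjk := mul_σ_mul_σ_of_not_adj hjk njk
  have rik := mul_σ_mul_σ_of_not_adj hik nik
  simp only [len_mul, len_σ] at hN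
  obtain ⟨f, h₁, rfl⟩ := H.comm (by simp; omega) h hik nik
  obtain ⟨g, rfl, rfl⟩ := H.comm (by omega) h₁ hjk njk
  refine ⟨g * σ n i * σ n j, ?_, ?_⟩
  · rw [compl_of_not_adj hik nik, ← rik, rjk]
  · rw [compl_of_not_adj hik.symm (fun h => nik h.symm), rij]

theorem lcmFactor_of_braid_braid_comm (H : LcmFactorBelow n N) (hik : i ≠ k)
    (aij : Adj i j) (ajk : Adj j k) (nik : ¬ Adj i k) (hN : len (c * σ n j * σ n i) ≤ N)
    (h : c * σ n j * σ n i = c' * σ n j * σ n k) :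
    LcmFactor (c * σ n i * σ n j) i (c' * σ n k * σ n j) k := by
  have rij := mul_σ_braid_of_adj aij
  have rjk := mul_σ_braid_of_adj ajk
  have rik := mul_σ_mul_σ_of_not_adj hik nik
  have hlen := congrArg len h
  simp only [len_mul, len_σ] at hN hlen
  obtain ⟨f, h₁, h₂⟩ := H.comm (by simp; omega) h hik nik
  obtain ⟨g, rfl, rfl⟩ := H.braid (by omega) h₁ ajk
  obtain ⟨l, rfl, h₃⟩ := H.braid (by omega) h₂ aij.symm
  simp only [len_mul, len_σ] at hN hlen
  obtain ⟨p, rfl, rfl⟩ := H.comm (by omega) (H.cancel (by simp; omega) h₃) hik.symm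
    (fun h => nik h.symm)
  -- The three generators span a 4-strand braid monoid with `j` in the middle; the witness followed
  -- by `σ n k * σ n i` is `p` times its Garside element, of length six.
  refine ⟨p * σ n j * σ n i * σ n k * σ n j, ?_, ?_⟩
  · rw [compl_of_not_adj hik nik, ← rik (p * σ n i * σ n j), rij, ← rjk]
  · rw [compl_of_not_adj hik.symm (fun h => nik h.symm), rik (p * σ n k * σ n j), ← rjk, ← rij,
      ← rik (p * σ n j)]

theorem lcmFactor_of_comm_braid_braid (H : LcmFactorBelow n N) (hij : i ≠ j)
    (nij : ¬ Adj i j) (ajk : Adj j k) (aik : Adj i k) (hN : len (c * σ n i) ≤ N)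
    (h : c * σ n i = c' * σ n j * σ n k) :
    LcmFactor (c * σ n j) i (c' * σ n k * σ n j) k := by
  have rij := mul_σ_mul_σ_of_not_adj hij nij
  have rjk := mul_σ_braid_of_adj ajk
  have rik := mul_σ_braid_of_adj aik
  have hlen := congrArg len h
  simp only [len_mul, len_σ] at hN hlen
  obtain ⟨f, rfl, h₁⟩ := H.braid (by omega) h aik
  obtain ⟨g, rfl, h₂⟩ := H.comm (by omega) h₁ hij.symm (fun h => nij h.symm)
  simp only [len_mul, len_σ] at hN hlen
  obtain ⟨l, rfl, rfl⟩ := H.braid (by omega) h₂ ajk.symm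
  refine ⟨l * σ n i * σ n k * σ n j, ?_, ?_⟩
  · rw [compl_of_adj aik, ← mul_assoc, ← rij (l * σ n k), rjk, ← rik,
      rij (l * σ n i * σ n k)]
  · rw [compl_of_adj aik.symm, ← mul_assoc, ← rjk, ← rik, ← rij, rij (l * σ n i * σ n j * σ n k)]

/-- Transitivity of `LcmFactor`. -/
theorem LcmFactor.trans {a b d : PosBraid n} (H : LcmFactorBelow n N) (hN : len b ≤ N)
    (h₁ : LcmFactor a i b j) (h₂ : LcmFactor b j d k) : LcmFactor a i d k := by
  obtain ⟨c, rfl, rfl⟩ := h₁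
  obtain ⟨c', h, rfl⟩ := h₂
  by_cases hij : i = j
  · subst hij
    exact ⟨c', by simpa [compl_self] using h, rfl⟩
  by_cases hjk : j = k
  · subst hjk
    refine ⟨c, rfl, ?_⟩
    simpa [compl_self] using h.symm
  by_cases hik : i = k
  · subst hik
    refine ⟨c * compl i j, by simp [compl_self], ?_⟩
    -- Cancelling the common complement is legitimate: each letter removed leaves a braid of length
    -- below `N`.
    suffices c = c' by simp [compl_self, this]
    by_cases aij : Adj j i
    · rw [compl_of_adj aij, ← mul_assoc, ← mul_assoc] at h
      rw [compl_of_adj aij] at hN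
      simp only [len_mul, len_σ] at hN
      exact H.cancel (by omega) (H.cancel (by simp; omega) h)
    · rw [compl_of_not_adj (Ne.symm hij) aij] at h hN
      simp only [len_mul, len_σ] at hN
      exact H.cancel (by omega) h
  have hji := Ne.symm hij
  have hkj := Ne.symm hjk
  have hlen := congrArg len h
  by_cases aij : Adj i j <;> by_cases ajk : Adj j k <;> by_cases aik : Adj i k
  -- Three indices on a line cannot be pairwise consecutive.
  · simp only [Adj] at *; omega
  all_goals
    first
    | have aji := aij.symm
      simp only [compl_of_adj aij, compl_of_adj aji, ← mul_assoc] at h hN hlen ⊢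
    | have nji : ¬ Adj j i := fun h => aij h.symm
      simp only [compl_of_not_adj hij aij, compl_of_not_adj hji nji] at h hN hlen ⊢
    first
    | have akj := ajk.symm
      simp only [compl_of_adj ajk, compl_of_adj akj, ← mul_assoc] at h hN hlen ⊢
    | have nkj : ¬ Adj k j := fun h => ajk h.symm
      simp only [compl_of_not_adj hjk ajk, compl_of_not_adj hkj nkj] at h hN hlen ⊢
  · exact lcmFactor_of_braid_braid_comm H hik aij ajk aik hN h
  · exact (lcmFactor_of_comm_braid_braid H hkj nkj aij.symm aik.symm (hlen ▸ hN) h.symm).symm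
  · exact lcmFactor_of_braid_comm_comm H hjk hik aij ajk aik hN h
  · exact lcmFactor_of_comm_braid_braid H hij aij ajk aik hN h
  · exact (lcmFactor_of_braid_comm_comm H hji (Ne.symm hik) ajk.symm nji (fun h => aik h.symm)
      (hlen ▸ hN) h.symm).symm
  · exact lcmFactor_of_comm_comm H hij hjk hik aij ajk hN h
  · exact lcmFactor_of_comm_comm H hij hjk hik aij ajk hN h

end Trans

/-! ### From words and derivations to right cancellation -/

/-- Two words are empty, or their last letters are completed to the left lcm inside both. -/
def WordFactor (u v : FreeMonoid (Fin (n - 1))) : Prop :=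
  (u = 1 ∧ v = 1) ∨ ∃ a b i j, u = a * .of i ∧ v = b * .of j ∧
    LcmFactor (PresentedMonoid.mk (PosBraidRel n) a) i (PresentedMonoid.mk (PosBraidRel n) b) j

theorem len_mk (u : FreeMonoid (Fin (n - 1))) :
    len (PresentedMonoid.mk (PosBraidRel n) u) = u.length := by
  induction u using FreeMonoid.inductionOn' with
  | one => simp
  | of_mul i u ih =>
    rw [map_mul, len_mul, ih, FreeMonoid.length_mul]; rfl

theorem mul_of_inj {α : Type*} {a b : FreeMonoid α} {i j : α}
    (h : a * FreeMonoid.of i = b * FreeMonoid.of j) : a = b ∧ i = j := by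
  have := congrArg FreeMonoid.toList h
  simp only [FreeMonoid.toList_mul, FreeMonoid.toList_of] at this
  have := List.append_inj' this rfl
  exact ⟨this.1, by simpa using this.2⟩

theorem mul_of_ne_one {α : Type*} (a : FreeMonoid α) (i : α) : a * FreeMonoid.of i ≠ 1 := by
  intro h
  simpa using congrArg FreeMonoid.length h

theorem eq_one_or_eq_mul_of {α : Type*} (u : FreeMonoid α) :
    u = 1 ∨ ∃ a i, u = a * FreeMonoid.of i :=
  List.eq_nil_or_concat' u

theorem WordFactor.refl (u : FreeMonoid (Fin (n - 1))) : WordFactor u u := by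
  obtain rfl | ⟨a, i, rfl⟩ := eq_one_or_eq_mul_of u
  · exact .inl ⟨rfl, rfl⟩
  · exact .inr ⟨a, a, i, i, rfl, rfl, _, by rw [compl_self, mul_one], by rw [compl_self, mul_one]⟩

theorem WordFactor.symm {u v : FreeMonoid (Fin (n - 1))} (h : WordFactor u v) :
    WordFactor v u := by
  obtain ⟨rfl, rfl⟩ | ⟨a, b, i, j, rfl, rfl, h⟩ := h
  · exact .inl ⟨rfl, rfl⟩
  · exact .inr ⟨b, a, j, i, rfl, rfl, h.symm⟩

theorem WordFactor.trans {N : ℕ} (H : LcmFactorBelow n N) {u v w : FreeMonoid (Fin (n - 1))}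
    (hN : v.length ≤ N + 1) (h₁ : WordFactor u v) (h₂ : WordFactor v w) : WordFactor u w := by
  obtain ⟨rfl, rfl⟩ | ⟨a, b, i, j, rfl, rfl, h⟩ := h₁
  · exact h₂
  obtain ⟨h', -⟩ | ⟨b', d, j', k, hb, rfl, h'⟩ := h₂
  · exact absurd h' (mul_of_ne_one _ _)
  obtain ⟨rfl, rfl⟩ := mul_of_inj hb
  refine .inr ⟨a, d, i, k, rfl, rfl, h.trans H ?_ h'⟩
  rw [len_mk]
  simpa using hN

/-- Only last letters matter: they come from `w` and `z` unless both are empty, and the equal braids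
of `u` and `v` are absorbed into the cofactor. -/
theorem WordFactor.mul {u v w z : FreeMonoid (Fin (n - 1))}
    (huv : PresentedMonoid.mk (PosBraidRel n) u = PresentedMonoid.mk (PosBraidRel n) v)
    (h₁ : WordFactor u v) (h₂ : WordFactor w z) : WordFactor (u * w) (v * z) := by
  obtain ⟨rfl, rfl⟩ | ⟨a, b, i, j, rfl, rfl, c, ha, hb⟩ := h₂
  · simpa using h₁
  · refine .inr ⟨u * a, v * b, i, j, by rw [mul_assoc], by rw [mul_assoc],
      PresentedMonoid.mk (PosBraidRel n) u * c, ?_, ?_⟩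
    · rw [map_mul, ha, mul_assoc]
    · rw [map_mul, hb, huv, mul_assoc]

theorem WordFactor.of_rel {u v : FreeMonoid (Fin (n - 1))} (h : PosBraidRel n u v) :
    WordFactor u v := by
  cases h with
  | comm i j h =>
    have hne : i ≠ j := by rintro rfl; omega
    have hadj : ¬ Adj i j := by simp only [Adj]; omega
    refine .inr ⟨_, _, j, i, rfl, rfl, 1, ?_, ?_⟩
    · rw [compl_of_not_adj hne.symm (fun h => hadj h.symm), one_mul]; rfl
    · rw [compl_of_not_adj hne hadj, one_mul]; rfl
  | braid i j h =>
    have h : Adj i j := h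
    refine .inr ⟨_, _, i, j, rfl, rfl, 1, ?_, ?_⟩
    · rw [compl_of_adj h, one_mul]; rfl
    · rw [compl_of_adj h.symm, one_mul]; rfl

/-- Relations preserve length, so the bound passes to every intermediate word, and removing a last
letter leaves length at most `N`, as chaining requires. -/
theorem wordFactor_of_conGen {N : ℕ} (H : LcmFactorBelow n N) {u v : FreeMonoid (Fin (n - 1))}
    (h : ConGen.Rel (PosBraidRel n) u v) (hN : u.length ≤ N + 1) : WordFactor u v := by
  have mk_eq {u v} (h : ConGen.Rel (PosBraidRel n) u v) :
      PresentedMonoid.mk (PosBraidRel n) u = PresentedMonoid.mk (PosBraidRel n) v :=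
    PresentedMonoid.mk_eq_mk_iff.2 h
  have length_eq {u v} (h : ConGen.Rel (PosBraidRel n) u v) : u.length = v.length := by
    rw [← len_mk, mk_eq h, len_mk]
  induction h with
  | of u v h => exact .of_rel h
  | refl u => exact .refl u
  | symm h ih => exact (ih (length_eq h ▸ hN)).symm
  | trans h₁ h₂ ih₁ ih₂ =>
    have := length_eq h₁ ▸ hN
    exact (ih₁ hN).trans H this (ih₂ this)
  | mul h₁ h₂ ih₁ ih₂ =>
    rw [FreeMonoid.length_mul] at hN
    exact .mul (mk_eq h₁) (ih₁ (by omega)) (ih₂ (by omega))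

theorem lcmFactorBelow (N : ℕ) : LcmFactorBelow n N := by
  induction N with
  | zero => intro a b i j h; simp at h
  | succ N H =>
    intro a b i j hlt h
    obtain ⟨u, rfl⟩ := PresentedMonoid.surjective_mk a
    obtain ⟨v, rfl⟩ := PresentedMonoid.surjective_mk b
    have h' : ConGen.Rel (PosBraidRel n) (u * .of i) (v * .of j) :=
      PresentedMonoid.mk_eq_mk_iff.1 h
    obtain ⟨h₀, -⟩ | ⟨a, b, i', j', ha, hb, hf⟩ := wordFactor_of_conGen H h' (by
      rw [len_mk] at hlt
      simp; omega)
    · exact absurd h₀ (mul_of_ne_one _ _)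
    · obtain ⟨rfl, rfl⟩ := mul_of_inj ha
      obtain ⟨rfl, rfl⟩ := mul_of_inj hb
      exact hf

/-- A common left multiple of `σ i` and `σ j` is a left multiple of their left lcm. -/
theorem lcmFactor_of_mul_σ_eq {a b : PosBraid n} {i j : Fin (n - 1)}
    (h : a * σ n i = b * σ n j) : LcmFactor a i b j :=
  lcmFactorBelow (len a + 1) a b i j (Nat.lt_succ_self _) h

/-- Positive braid monoids are right cancellative. -/
theorem mul_right_cancel_posBraid {a b : PosBraid n} (z : PosBraid n) : a * z = b * z → a = b := by
  induction z using right_induction with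
  | one => simp
  | mul_σ z i ih =>
    intro h
    rw [← mul_assoc, ← mul_assoc] at h
    obtain ⟨c, h₁, h₂⟩ := lcmFactor_of_mul_σ_eq h
    exact ih (h₁.trans h₂.symm)

/-! ### The submonoid, common multiples and tails -/

/-- The indicator of `B_{n-1}^+`: it maps the last generator to `0` and all others to `1`. -/
def indicator (n : ℕ) : PosBraid n →* ℕ :=
  PresentedMonoid.lift (fun i => if i.val < n - 1 - 1 then 1 else 0) (by
    intro a b h
    cases h with
    | comm i j h => simp [mul_comm]
    | braid i j h => by_cases hi : i.val < n - 1 - 1 <;> simp [hi])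

theorem indicator_σ (i : Fin (n - 1)) :
    indicator n (σ n i) = if i.val < n - 1 - 1 then 1 else 0 := rfl

theorem σ_mem_sub {i : Fin (n - 1)} (h : i.val < n - 1 - 1) : σ n i ∈ sub n :=
  ⟨σ (n - 1) ⟨i, h⟩, rfl⟩

/-- In `ℕ` a product is `1` only if both factors are, so this form makes closure under divisors
immediate. -/
theorem mem_sub_iff {x : PosBraid n} : x ∈ sub n ↔ indicator n x = 1 := by
  constructor
  · rintro ⟨y, rfl⟩
    induction y using right_induction with
    | one => simp
    | mul_σ y i ih =>
      rw [map_mul, map_mul, ih, one_mul]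
      change indicator n (σ n (Fin.castLE (Nat.sub_le (n - 1) 1) i)) = 1
      simp [indicator_σ, i.isLt]
  · induction x using right_induction with
    | one => exact fun _ => one_mem _
    | mul_σ x i ih =>
      intro h
      rw [map_mul, mul_eq_one, indicator_σ] at h
      exact mul_mem (ih h.1) (σ_mem_sub (by by_contra h'; simp [h'] at h))

theorem mul_mem_sub_iff {x y : PosBraid n} : x * y ∈ sub n ↔ x ∈ sub n ∧ y ∈ sub n := by
  simp [mem_sub_iff]

theorem σ_mem_sub_iff {i : Fin (n - 1)} : σ n i ∈ sub n ↔ i.val < n - 1 - 1 := by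
  rw [mem_sub_iff, indicator_σ]
  split_ifs with h <;> simp [h]

theorem compl_mem_sub {i j : Fin (n - 1)} (hi : σ n i ∈ sub n) (hj : σ n j ∈ sub n) :
    compl i j ∈ sub n := by
  unfold compl
  split_ifs
  exacts [one_mem _, mul_mem hi hj, hj]

/-- Two right divisors in `B_{n-1}^+` have a common left multiple in `B_{n-1}^+` among the
right divisors. -/
theorem exists_common_multiple (y z z' : PosBraid n) (hz : z ∈ sub n) (hz' : z' ∈ sub n)
    (h : RightDvd z y) (h' : RightDvd z' y) :
    ∃ m ∈ sub n, RightDvd m y ∧ RightDvd z m ∧ RightDvd z' m := by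
  induction hl : len y using Nat.strong_induction_on generalizing y z z' with
  | _ l ih =>
    subst hl
    obtain rfl | ⟨z, i, rfl⟩ := eq_one_or_eq_mul_σ z
    · exact ⟨z', hz', h', ⟨z', by simp⟩, .refl _⟩
    obtain rfl | ⟨z', j, rfl⟩ := eq_one_or_eq_mul_σ z'
    · exact ⟨_, hz, h, .refl _, ⟨z * σ n i, by simp⟩⟩
    obtain ⟨y₁, rfl⟩ := h
    obtain ⟨y₂, h₂⟩ := h'
    obtain ⟨hz, hi⟩ := mul_mem_sub_iff.1 hz
    obtain ⟨hz', hj⟩ := mul_mem_sub_iff.1 hz'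
    rw [← mul_assoc, ← mul_assoc] at h₂
    obtain ⟨c, hc₁, hc₂⟩ := lcmFactor_of_mul_σ_eq h₂
    have hlen := congrArg len h₂
    simp only [len_mul, len_σ] at hlen
    -- Strip the last letters `i` and `j`, and on each side merge the rest of the divisor with the
    -- complement. Both results divide off a left part of the same `c`, where `t₁` and `t₂` are
    -- merged in turn.
    obtain ⟨m₁, hm₁, ⟨v₁, hv₁⟩, ⟨w₁, rfl⟩, ⟨t₁, ht₁⟩⟩ := ih (len (y₁ * z)) (by simp)
      (y₁ * z) z (compl i j) hz (compl_mem_sub hi hj) ⟨y₁, rfl⟩ ⟨c, hc₁⟩ rfl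
    obtain ⟨m₂, hm₂, ⟨v₂, hv₂⟩, ⟨w₂, rfl⟩, ⟨t₂, ht₂⟩⟩ := ih (len (y₂ * z')) (by simp; omega)
      (y₂ * z') z' (compl j i) hz' (compl_mem_sub hj hi) ⟨y₂, rfl⟩ ⟨c, hc₂⟩ rfl
    have e₁ : c = v₁ * t₁ := by
      apply mul_right_cancel_posBraid (compl i j)
      rw [← hc₁, hv₁, ht₁, mul_assoc]
    have e₂ : c = v₂ * t₂ := by
      apply mul_right_cancel_posBraid (compl j i)
      rw [← hc₂, hv₂, ht₂, mul_assoc]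
    obtain ⟨m, hm, ⟨v, rfl⟩, ⟨s₁, hs₁⟩, ⟨s₂, hs₂⟩⟩ := ih (len c)
      (by have := congrArg len hc₁
          simp only [len_mul, len_σ] at this ⊢
          omega) c t₁ t₂
      (mul_mem_sub_iff.1 (ht₁ ▸ hm₁)).1 (mul_mem_sub_iff.1 (ht₂ ▸ hm₂)).1 ⟨v₁, e₁⟩ ⟨v₂, e₂⟩ rfl
    refine ⟨m * compl i j * σ n i, mul_mem (mul_mem hm (compl_mem_sub hi hj)) hi,
      ⟨v, ?_⟩, ⟨s₁ * w₁, ?_⟩, ⟨s₂ * w₂, ?_⟩⟩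
    · rw [← mul_assoc, hc₁]; simp only [mul_assoc]
    · rw [hs₁, mul_assoc s₁, ← ht₁]; simp only [mul_assoc]
    · rw [mul_assoc, compl_mul_σ, ← mul_assoc, hs₂, mul_assoc s₂, ← ht₂]; simp only [mul_assoc]

theorem rightDvd_antisymm {s t : PosBraid n} (h : RightDvd s t) (h' : RightDvd t s) : s = t := by
  obtain ⟨u, rfl⟩ := h
  obtain ⟨v, hv⟩ := h'
  have := congrArg len hv
  simp only [len_mul] at this
  rw [eq_one_of_len_eq_zero (x := u) (by omega), one_mul]

/-- A right divisor in `sub n` of maximal length works: its common multiple with any other cannot be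
longer, hence equals it. -/
theorem exists_isTail (y : PosBraid n) : ∃ t, IsTail y (sub n : Set (PosBraid n)) t := by
  obtain ⟨t, ⟨ht, hty⟩, hmax⟩ : ∃ t, (t ∈ sub n ∧ RightDvd t y) ∧
      ∀ z, z ∈ sub n ∧ RightDvd z y → len z ≤ len t := by
    have hb : ∃ l, ∃ t : PosBraid n, (t ∈ sub n ∧ RightDvd t y) ∧ len y - len t = l :=
      ⟨_, 1, ⟨one_mem _, ⟨y, by simp⟩⟩, rfl⟩
    classical
    obtain ⟨t, ht, hl⟩ := Nat.find_spec hb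
    refine ⟨t, ht, fun z hz => ?_⟩
    have h₁ := Nat.find_min' hb ⟨z, hz, rfl⟩
    obtain ⟨u, hu⟩ := hz.2
    have := congrArg len hu
    simp only [len_mul] at this
    omega
  refine ⟨t, ht, hty, fun z hz hzy => ?_⟩
  obtain ⟨m, hm, hmy, ⟨u, rfl⟩, hzm⟩ := exists_common_multiple y t z ht hz hty hzy
  have := hmax _ ⟨hm, hmy⟩
  simp only [len_mul] at this
  rwa [eq_one_of_len_eq_zero (x := u) (by omega), one_mul] at hzm

theorem existsUnique_isTail (y : PosBraid n) : ∃! t, IsTail y (sub n : Set (PosBraid n)) t :=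
  existsUnique_of_exists_of_unique (exists_isTail y) fun _ _ h h' =>
    rightDvd_antisymm (h'.2.2 _ h.1 h.2.1) (h.2.2 _ h'.1 h'.2.1)

theorem existsUnique_rightQuot {y z : PosBraid n} (h : RightDvd z y) : ∃! q, y = q * z :=
  existsUnique_of_exists_of_unique h fun _ _ h₁ h₂ =>
    mul_right_cancel_posBraid z (h₁.symm.trans h₂)

theorem isTail_tail (y : PosBraid n) : IsTail y (sub n : Set (PosBraid n)) (tail y (sub n)) := by
  rw [tail, dif_pos (exists_isTail y)]
  exact (exists_isTail y).choose_spec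

theorem tail_eq_of_isTail {y t : PosBraid n} (h : IsTail y (sub n : Set (PosBraid n)) t) :
    tail y (sub n) = t :=
  (existsUnique_isTail y).unique (isTail_tail y) h

theorem rightQuot_mul_self (q z : PosBraid n) : rightQuot (q * z) z = q := by
  have h : ∃ q' : PosBraid n, q * z = q' * z := ⟨q, rfl⟩
  rw [rightQuot, dif_pos h]
  exact (mul_right_cancel_posBraid z h.choose_spec).symm

/-- `q * t` has tail `t` as soon as `t` is in `B_{n-1}^+` and no generator of `B_{n-1}^+` is a
right divisor of `q`. -/
theorem isTail_mul {q t : PosBraid n} (ht : t ∈ sub n)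
    (hq : ∀ i, σ n i ∈ sub n → ¬ RightDvd (σ n i) q) :
    IsTail (q * t) (sub n : Set (PosBraid n)) t := by
  obtain ⟨s, hs⟩ := exists_isTail (q * t)
  obtain ⟨u, rfl⟩ := hs.2.2 t ht ⟨q, rfl⟩
  obtain ⟨v, hv⟩ := hs.2.1
  rw [← mul_assoc] at hv
  have hqv := mul_right_cancel_posBraid t hv
  obtain rfl | ⟨u, i, rfl⟩ := eq_one_or_eq_mul_σ u
  · simpa using hs
  · refine absurd ⟨v * u, by rw [hqv, mul_assoc]⟩ (hq i ?_)
    exact (mul_mem_sub_iff.1 (mul_mem_sub_iff.1 hs.1).1).2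

/-- Otherwise `σ n i * t` would be a longer right divisor in `sub n`. -/
theorem not_rightDvd_of_isTail {q t : PosBraid n} (h : IsTail (q * t) (sub n : Set (PosBraid n)) t)
    {i : Fin (n - 1)} (hi : σ n i ∈ sub n) : ¬ RightDvd (σ n i) q := by
  rintro ⟨p, rfl⟩
  obtain ⟨u, hu⟩ := h.2.2 (σ n i * t) (mul_mem hi h.1) ⟨p, by rw [mul_assoc]⟩
  have := congrArg len hu
  simp only [len_mul, len_σ] at this
  omega

/-! ### The flip and the condition on right divisors -/

@[simp] theorem flip_σ (i : Fin (n - 1)) : flip n (σ n i) = σ n i.rev := rfl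

@[simp] theorem flip_flip (x : PosBraid n) : flip n (flip n x) = x := by
  induction x using right_induction with
  | one => simp
  | mul_σ x i ih => simp [ih]

@[simp] theorem len_flip (x : PosBraid n) : len (flip n x) = len x := by
  induction x using right_induction with
  | one => simp
  | mul_σ x i ih => simp [ih]

theorem rightDvd_flip {x y : PosBraid n} (h : RightDvd x y) : RightDvd (flip n x) (flip n y) := by
  obtain ⟨u, rfl⟩ := h
  exact ⟨flip n u, map_mul _ _ _⟩

theorem σ_rightDvd_flip_iff {i : Fin (n - 1)} {x : PosBraid n} :
    RightDvd (σ n i) (flip n x) ↔ RightDvd (σ n i.rev) x := by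
  constructor <;> intro h <;> simpa using rightDvd_flip h

/-- `σ_1` is the only generator that is a right divisor of `x`. -/
def OnlyFirst (x : PosBraid n) : Prop := ∀ i : Fin (n - 1), RightDvd (σ n i) x ↔ i.val = 0

theorem OnlyFirst.ne_one (hn : 3 ≤ n) {x : PosBraid n} (h : OnlyFirst x) : x ≠ 1 := by
  rintro rfl
  obtain ⟨u, hu⟩ := (h ⟨0, by omega⟩).2 rfl
  simpa using congrArg len hu

theorem isTail_flip_mul {y t : PosBraid n} (ht : t ∈ sub n)
    (hy : OnlyFirst y) : IsTail (flip n y * t) (sub n : Set (PosBraid n)) t := by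
  refine isTail_mul ht fun i hi h => ?_
  rw [σ_rightDvd_flip_iff, hy, Fin.val_rev] at h
  rw [σ_mem_sub_iff] at hi
  omega

/-- A nontrivial `q` ends with some generator; it is outside `sub n`, so it is the last one, which
the flip turns into the first. -/
theorem onlyFirst_flip {q t : PosBraid n} (h : IsTail (q * t) (sub n : Set (PosBraid n)) t)
    (hq : q ≠ 1) : OnlyFirst (flip n q) := by
  have key (i : Fin (n - 1)) (hi : RightDvd (σ n i.rev) q) : i.val = 0 := by
    by_contra h0
    refine not_rightDvd_of_isTail h (σ_mem_sub_iff.2 ?_) hi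
    rw [Fin.val_rev]
    omega
  obtain rfl | ⟨p, j, rfl⟩ := eq_one_or_eq_mul_σ q
  · exact absurd rfl hq
  intro i
  rw [σ_rightDvd_flip_iff]
  refine ⟨key i, fun hi => ?_⟩
  have hj := key j.rev (by rw [Fin.rev_rev]; exact ⟨p, rfl⟩)
  rw [show i.rev = j by rw [Fin.ext (hi.trans hj.symm), Fin.rev_rev]]
  exact ⟨p, rfl⟩

/-! ### Recursive form of splittings -/

@[simp] theorem flipProd_nil : flipProd n [] = 1 := rfl

/-- Horner form of the product: one flip is factored out of all later entries, since the flip is a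
homomorphism. -/
theorem flipProd_cons (y : PosBraid n) (L : List (PosBraid n)) :
    flipProd n (y :: L) = flip n (flipProd n L) * y := by
  have h : (L.mapIdx fun k y => (flip n)^[k] y).map (flip n) =
      L.mapIdx fun k y => flip n ((flip n)^[k] y) := by
    apply List.ext_getElem?
    simp [Function.comp_def]
  simp [flipProd, List.mapIdx_cons, map_list_prod, List.map_reverse, h,
    Function.iterate_succ_apply']

theorem isSplitting_singleton {x y : PosBraid n} :
    IsSplitting n x [y] ↔ y ∈ sub n ∧ x = y := by
  have h1 : ∀ r : ℕ, 2 ≤ r → r ≤ 1 → False := by omega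
  simp only [IsSplitting, flipProd_cons]
  constructor
  · rintro ⟨-, h, rfl, -⟩
    exact ⟨h y (by simp), by simp⟩
  · rintro ⟨h, rfl⟩
    exact ⟨by simp, by simpa using h, by simp, fun r h₁ h₂ => (h1 r h₁ h₂).elim⟩

theorem isSplitting_cons {x y : PosBraid n} {L : List (PosBraid n)} (hL : L ≠ []) :
    IsSplitting n x (y :: L) ↔ y ∈ sub n ∧ x = flip n (flipProd n L) * y ∧
      OnlyFirst (flipProd n L) ∧ IsSplitting n (flipProd n L) L := by
  have hpos := List.length_pos_iff.2 hL
  simp only [IsSplitting, flipProd_cons]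
  constructor
  · rintro ⟨-, h, rfl, hr⟩
    refine ⟨h y (by simp), rfl, ?_, hL, fun z hz => h z (by simp [hz]), trivial, ?_⟩
    · exact hr 2 le_rfl (by simp; omega)
    · intro r h₁ h₂
      obtain ⟨r, rfl⟩ := Nat.exists_eq_add_of_le h₁
      have := hr (2 + r + 1) (by omega) (by simp; omega)
      rwa [show 2 + r + 1 - 1 = (1 + r) + 1 by omega, List.drop_succ_cons,
        show 1 + r = 2 + r - 1 by omega] at this
  · rintro ⟨hy, rfl, hf, -, hm, -, hr⟩
    refine ⟨by simp, by simpa [hy] using hm, rfl, ?_⟩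
    intro r h₁ h₂
    obtain ⟨r, rfl⟩ := Nat.exists_eq_add_of_le h₁
    rw [show 2 + r - 1 = r + 1 by omega, List.drop_succ_cons]
    cases r with
    | zero => exact hf
    | succ r => exact hr (r + 2) (by omega) (by simp at h₂; omega)

/-! ### Iterated tails, existence and uniqueness -/

theorem remainder_succ_eq (x : PosBraid n) (r : ℕ) :
    remainder n x (r + 1) = remainder n (remainder n x 1) r := by
  induction r with
  | zero => rfl
  | succ r ih => rw [remainder, ih]; rfl

theorem remainder_one_of_isTail {q t : PosBraid n}
    (h : IsTail (q * t) (sub n : Set (PosBraid n)) t) :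
    remainder n (q * t) 1 = flip n q := by
  rw [remainder, remainder, tail_eq_of_isTail h, rightQuot_mul_self]

theorem isTail_self {t : PosBraid n} (ht : t ∈ sub n) :
    IsTail t (sub n : Set (PosBraid n)) t := ⟨ht, .refl _, fun _ _ h => h⟩

/-- The entries and the length of a splitting are given by the iterated tails. -/
theorem IsSplitting.determined (hn : 3 ≤ n) {x : PosBraid n} {L : List (PosBraid n)}
    (h : IsSplitting n x L) :
    (∀ r < L.length, L[r]? = some (tail (remainder n x r) (sub n))) ∧
      (∀ r : ℕ, 1 ≤ r → r < L.length → remainder n x r ≠ 1) ∧ remainder n x L.length = 1 := by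
  induction L generalizing x with
  | nil => exact absurd rfl h.1
  | cons y L ih =>
    by_cases hL : L = []
    · subst hL
      obtain ⟨hy, rfl⟩ := isSplitting_singleton.1 h
      have ht := isTail_self hy
      refine ⟨fun r hr => ?_, fun r h₁ h₂ => ?_, ?_⟩
      · obtain rfl : r = 0 := by simpa using hr
        simp [remainder, tail_eq_of_isTail ht]
      · simp at h₂; omega
      · have h1 := remainder_one_of_isTail (q := 1) (t := x) (by simpa using ht)
        simpa using h1
    · obtain ⟨hy, rfl, hf, hs⟩ := (isSplitting_cons hL).1 h
      -- The first entry is the tail, so the first remainder is the product of the remaining list,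
      -- to which induction applies.
      have ht := isTail_flip_mul hy hf
      have h1 := remainder_one_of_isTail ht
      rw [flip_flip] at h1
      obtain ⟨ih₁, ih₂, ih₃⟩ := ih hs
      refine ⟨fun r hr => ?_, fun r h₁ h₂ => ?_, ?_⟩
      · cases r with
        | zero => simp [remainder, tail_eq_of_isTail ht]
        | succ r =>
          rw [remainder_succ_eq, h1, List.getElem?_cons_succ]
          exact ih₁ r (by simpa using hr)
      · obtain ⟨r, rfl⟩ := Nat.exists_eq_add_of_le' h₁
        rw [remainder_succ_eq, h1]
        cases r with
        | zero => exact hf.ne_one hn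
        | succ r => exact ih₂ _ (by omega) (by simpa using h₂)
      · rw [List.length_cons, remainder_succ_eq, h1, ih₃]

theorem exists_isSplitting_of_flip {q t : PosBraid n}
    (h : IsTail (q * t) (sub n : Set (PosBraid n)) t)
    (ih : OnlyFirst (flip n q) → ∃ L, IsSplitting n (flip n q) L) :
    ∃ L, IsSplitting n (q * t) L := by
  by_cases hq : q = 1
  · subst hq
    exact ⟨[t], isSplitting_singleton.2 ⟨h.1, one_mul t⟩⟩
  · have hf := onlyFirst_flip h hq
    obtain ⟨L, hL⟩ := ih hf
    have e : flip n q = flipProd n L := hL.2.2.1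
    refine ⟨t :: L, (isSplitting_cons hL.1).2 ⟨h.1, ?_, e ▸ hf, e ▸ hL⟩⟩
    rw [← e, flip_flip]

theorem exists_isSplitting_of_onlyFirst (hn : 3 ≤ n) (x : PosBraid n) (hx : OnlyFirst x) :
    ∃ L, IsSplitting n x L := by
  induction hl : len x using Nat.strong_induction_on generalizing x with
  | _ l ih =>
    subst hl
    obtain ⟨t, ht⟩ := exists_isTail x
    obtain ⟨q, rfl⟩ := ht.2.1
    refine exists_isSplitting_of_flip ht fun hf => ih _ ?_ _ hf rfl
    -- As `3 ≤ n`, the first generator lies in `sub n`; it therefore divides the tail, and the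
    -- quotient is strictly shorter.
    obtain ⟨u, rfl⟩ := ht.2.2 (σ n ⟨0, by omega⟩)
      (σ_mem_sub_iff.2 (show 0 < n - 1 - 1 by omega)) ((hx _).2 rfl)
    simp

/-- The tail of an arbitrary `x` may be trivial, so the first removal stands outside the induction
on length. -/
theorem exists_isSplitting (hn : 3 ≤ n) (x : PosBraid n) : ∃ L, IsSplitting n x L := by
  obtain ⟨t, ht⟩ := exists_isTail x
  obtain ⟨q, rfl⟩ := ht.2.1
  exact exists_isSplitting_of_flip ht (exists_isSplitting_of_onlyFirst hn _)

theorem IsSplitting.unique (hn : 3 ≤ n) {x : PosBraid n} {L L' : List (PosBraid n)}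
    (h : IsSplitting n x L) (h' : IsSplitting n x L') : L = L' := by
  obtain ⟨h₁, h₂, h₃⟩ := h.determined hn
  obtain ⟨h₁', h₂', h₃'⟩ := h'.determined hn
  have hpos := List.length_pos_iff.2 h.1
  have hpos' := List.length_pos_iff.2 h'.1
  have hlen : L.length = L'.length := by
    rcases lt_trichotomy L.length L'.length with hlt | heq | hlt
    · exact absurd h₃ (h₂' _ hpos hlt)
    · exact heq
    · exact absurd h₃' (h₂ _ hpos' hlt)
  apply List.ext_getElem?
  intro r
  by_cases hr : r < L.length
  · rw [h₁ r hr, h₁' r (hlen ▸ hr)]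
  · rw [List.getElem?_eq_none (by omega), List.getElem?_eq_none (by omega)]

end PosBraid

theorem proposition4p1 (n : ℕ) (hn : 3 ≤ n) :
    -- tails and right quotients exist and are unique, so that `tail` and `rightQuot` mean what
    -- they should
    (∀ y : PosBraid n, ∃! t, IsTail y (PosBraid.sub n : Set (PosBraid n)) t) ∧
    (∀ y z : PosBraid n, RightDvd z y → ∃! q, y = q * z) ∧
    ∀ x : PosBraid n,
      (∃! L : List (PosBraid n), PosBraid.IsSplitting n x L) ∧
      -- the entries `x_r` are the tails of the `x^{(r-1)}`, and the length is the least `p ≥ 1`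
      -- with `x^{(p)} = 1`
      ∀ L : List (PosBraid n), PosBraid.IsSplitting n x L →
        (∀ r : ℕ, 1 ≤ r → r ≤ L.length →
          L[r - 1]? = some (tail (PosBraid.remainder n x (r - 1)) (PosBraid.sub n))) ∧
        (∀ r : ℕ, 1 ≤ r → r < L.length → PosBraid.remainder n x r ≠ 1) ∧
        PosBraid.remainder n x L.length = 1 := by

  refine ⟨PosBraid.existsUnique_isTail, fun y z => PosBraid.existsUnique_rightQuot, fun x =>
    ⟨existsUnique_of_exists_of_unique (PosBraid.exists_isSplitting hn x) fun _ _ h h' =>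
      h.unique hn h', fun L h => ?_⟩⟩
  obtain ⟨h₁, h₂, h₃⟩ := h.determined hn
  exact ⟨fun r hr hr' => h₁ (r - 1) (by omega), h₂, h₃⟩
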